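/- Let $A$ be a commutative ring, $B$ a commutative $A$-algebra and $M$ a $B$-module. Let $\Omega^1_{B/A}$ be the module of Kähler differentials, and let $\mathsf{L}_{B/A}$ be the cotangent complex, i.e. the complex of $B$-modules associated with the simplicial $B$-module $B\otimes_{P_\bullet}\Omega^1_{P_\bullet/A}$, where $P_\bullet\to B$ is the standard simplicial resolution of $B$ by polynomial $A$-algebras ($P_0=A[B]$, $P_1=A[A[B]]$, …). Then the natural homomorphism $$\pi:\operatorname{Ext}^1_B(\Omega^1_{B/A},M)\to\operatorname{Ext}^1_B(\mathsf{L}_{B/A},M)=\operatorname{Hom}_{D(B)}(\mathsf{L}_{B/A},M[1])$$ induced by the natural map $\mathsf{L}_{B/A}\to\Omega^1_{B/A}$ is injective. In particular, if $\operatorname{Ext}^1_B(\Omega^1_{B/A},M)\neq 0$, then there exists a non-trivial square-zero extension of $B$ by $M$ over $A$, i.e. a short exact sequence $0\to M\xrightarrow{i}E\xrightarrow{p}B\to 0$, where $E$ is a commutative $A$-algebra, $p$ is a surjective homomorphism of $A$-algebras, $i(M)^2=0$ and $i(p(e)m)=e\,i(m)$ for all $e\in E$, $m\in M$, such that $p$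 has no section $B\to E$ that is a homomorphism of $A$-algebras. -/

import Mathlib

open CategoryTheory
open scoped TensorProduct KaehlerDifferential

universe w u

noncomputable section

open TensorProduct KaehlerDifferential

namespace Cotangent

/-! ### The standard (bar) resolution attached to an endofunctor with a counit -/

section Bar

variable {C : Type*} [Category C] (G : C ⥤ C) (ε : G ⟶ 𝟭 C) (X : C)

/-- The iterates `Gⁿ X`; the term of simplicial degree `n` of the standard resolution of `X`
is `Gⁿ⁺¹ X`. -/
def iter : ℕ → C
  | 0 => X
  | n + 1 => G.obj (iter n)

/-- The counit `ε : G (Gⁿ X) ⟶ Gⁿ X`. -/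
def counit (n : ℕ) : iter G X (n + 1) ⟶ iter G X n := ε.app (iter G X n)

/-- The face maps `dᵢ = Gⁱ ε Gⁿ⁻ⁱ : Gⁿ⁺¹ X ⟶ Gⁿ X`, `0 ≤ i ≤ n`. For `n = 0` this is the
augmentation `ε : G X ⟶ X`. -/
def face : (n : ℕ) → Fin (n + 1) → (iter G X (n + 1) ⟶ iter G X n)
  | 0 => fun _ => counit G ε X 0
  | n + 1 => Fin.cases (counit G ε X (n + 1)) (fun i => G.map (face n i))

variable {D : Type*} [Category D] [Preadditive D]

/-- The alternating sum `∑ (-1)ⁱ L(dᵢ)` of the images of the face maps under a functor `L`. -/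
def altFace (L : C ⥤ D) (n : ℕ) : L.obj (iter G X (n + 1)) ⟶ L.obj (iter G X n) :=
  ∑ i : Fin (n + 1), (-1 : ℤ) ^ (i : ℕ) • L.map (face G ε X n i)

/-- The alternating sum `∑ (-1)ⁱ L(G(dᵢ))`. -/
def altFaceG (L : C ⥤ D) (n : ℕ) : L.obj (iter G X (n + 2)) ⟶ L.obj (iter G X (n + 1)) :=
  altFace G ε X (G ⋙ L) n

theorem altFace_zero (L : C ⥤ D) : altFace G ε X L 0 = L.map (counit G ε X 0) := by
  simp [altFace, face]

theorem altFace_succ (L : C ⥤ D) (n : ℕ) :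
    altFace G ε X L (n + 1) =
      L.map (counit G ε X (n + 1)) - altFaceG G ε X L n := by
  rw [altFace, Fin.sum_univ_succ, sub_eq_add_neg]
  congr 1
  · simp only [Fin.val_zero, pow_zero, one_smul]
    rfl
  · rw [altFaceG, altFace]
    erw [← Finset.sum_neg_distrib]
    refine Finset.sum_congr rfl fun i _ => ?_
    simp only [face, Fin.val_succ, pow_succ, mul_neg, mul_one, neg_smul]
    rfl

theorem altFaceG_naturality (L : C ⥤ D) (n : ℕ) :
    altFaceG G ε X L n ≫ L.map (counit G ε X n) =
      L.map (counit G ε X (n + 1)) ≫ altFace G ε X L n := by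
  rw [altFaceG, altFace, altFace, Preadditive.comp_sum]
  refine (Preadditive.sum_comp _ _ _).trans (Finset.sum_congr rfl fun i _ => ?_)
  refine (Preadditive.zsmul_comp _ _ _).trans
    (Eq.trans ?_ (Preadditive.comp_zsmul _ _ _).symm)
  have h : G.map (face G ε X n i) ≫ counit G ε X n =
      counit G ε X (n + 1) ≫ face G ε X n i := ε.naturality (face G ε X n i)
  exact congrArg _ ((L.map_comp _ _).symm.trans ((congrArg L.map h).trans (L.map_comp _ _)))

theorem altFace_comp (L : C ⥤ D) (n : ℕ) :
    altFace G ε X L (n + 1) ≫ altFace G ε X L n = 0 := by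
  induction n generalizing L with
  | zero =>
    have h := altFaceG_naturality G ε X L 0
    rw [altFace_zero] at h ⊢
    rw [altFace_succ, Preadditive.sub_comp, h, sub_self]
  | succ n ih =>
    have h1 := altFaceG_naturality G ε X L (n + 1)
    have h2 : altFaceG G ε X L (n + 1) ≫ altFaceG G ε X L n = 0 := ih (G ⋙ L)
    rw [altFace_succ G ε X L (n + 1), Preadditive.sub_comp, ← h1, altFace_succ G ε X L n,
      Preadditive.comp_sub, h2]
    simp

/-- The chain complex of the simplicial object `n ↦ L(Gⁿ⁺¹ X)`: its differentials are the
alternating sums of the face maps (so that the degeneracies play no role). -/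
def barComplex (L : C ⥤ D) : ChainComplex D ℕ :=
  ChainComplex.of (fun n => L.obj (iter G X (n + 1))) (fun n => altFace G ε X L (n + 1))
    (fun n => altFace_comp G ε X L (n + 1))

theorem barComplex_d (L : C ⥤ D) (n : ℕ) :
    (barComplex G ε X L).d (n + 1) n = altFace G ε X L (n + 1) := by
  simp [barComplex]

end Bar

/-! ### `A`-algebras over `B`: free algebras and differentials -/

theorem diff_hom_ext {A B P : Type u} [CommRing A] [CommRing B] [CommRing P] [Algebra A P]
    [Algebra P B] {N : Type*} [AddCommGroup N] [Module B N]
    {f f' : B ⊗[P] Ω[P⁄A] →ₗ[B] N}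
    (h : ∀ p, f ((1 : B) ⊗ₜ D A P p) = f' ((1 : B) ⊗ₜ D A P p)) : f = f' := by
  ext x
  induction x using TensorProduct.induction_on with
  | zero => simp
  | add x y hx hy => simp [hx, hy]
  | tmul b ω =>
    have hω : ω ∈ Submodule.span P (Set.range (D A P)) := by
      rw [KaehlerDifferential.span_range_derivation]; trivial
    induction hω using Submodule.span_induction generalizing b with
    | zero => simp
    | add x y _ _ hx hy => simp [tmul_add, hx, hy]
    | smul c x _ hx => rw [← smul_tmul]; exact hx _
    | mem x hx =>
      obtain ⟨p, rfl⟩ := hx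
      rw [← mul_one b, ← smul_eq_mul, ← smul_tmul', map_smul, map_smul, h]

section Algebras

variable (A B : Type u) [CommRing A] [CommRing B] [Algebra A B]

/-- The category of `A`-algebras `P` with an `A`-algebra map `P → B`. -/
abbrev AlgOver := Over (CommAlgCat.of A B)

variable {A B} in
/-- The structure map `P → B`. -/
def AlgOver.toB (P : AlgOver A B) : P.left →ₐ[A] B := P.hom.hom

variable {A B} in
/-- The `A`-algebra map underlying a morphism of `A`-algebras over `B`. -/
def AlgOver.map {P Q : AlgOver A B} (g : P ⟶ Q) : P.left →ₐ[A] Q.left := g.left.hom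

variable {A B} in
theorem AlgOver.toB_map {P Q : AlgOver A B} (g : P ⟶ Q) (p : P.left) :
    Q.toB (AlgOver.map g p) = P.toB p :=
  congrArg (fun f : P.left ⟶ CommAlgCat.of A B => f.hom p) (Over.w g)

/-- The functor sending `P → B` to the polynomial algebra `A[P]` on the underlying set of `P`,
with the composite map `A[P] → P → B`, the first map sending the variable `[p]` to `p`. -/
def freeAlg : AlgOver A B ⥤ AlgOver A B where
  obj P := Over.mk (Y := CommAlgCat.of A (MvPolynomial P.left A))
    (CommAlgCat.ofHom (P.toB.comp (MvPolynomial.aeval id)))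
  map {P Q} g := Over.homMk (CommAlgCat.ofHom (MvPolynomial.rename (AlgOver.map g))) (by
    ext : 1
    refine MvPolynomial.algHom_ext fun p => ?_
    change Q.toB (MvPolynomial.aeval id (MvPolynomial.rename (AlgOver.map g)
      (MvPolynomial.X p))) = P.toB (MvPolynomial.aeval id (MvPolynomial.X p))
    simp [AlgOver.toB_map])
  map_id P := by
    ext : 2
    exact MvPolynomial.algHom_ext fun p => MvPolynomial.rename_X _ _
  map_comp {P Q R} f g := by
    ext : 2
    exact MvPolynomial.algHom_ext fun p => (MvPolynomial.rename_X _ _).trans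
      ((congrArg (MvPolynomial.rename (AlgOver.map g)) (MvPolynomial.rename_X _ _)).trans
        (MvPolynomial.rename_X _ _)).symm

/-- The counit `A[P] → P`, sending the variable `[p]` to `p`. -/
def freeAlgCounit : freeAlg A B ⟶ 𝟭 (AlgOver A B) where
  app P := Over.homMk (CommAlgCat.ofHom (MvPolynomial.aeval id)) (by
    ext : 1
    rfl)
  naturality P Q g := by
    ext : 2
    refine MvPolynomial.algHom_ext fun p => ?_
    change MvPolynomial.aeval id (MvPolynomial.rename (AlgOver.map g) (MvPolynomial.X p)) =
      AlgOver.map g (MvPolynomial.aeval id (MvPolynomial.X p))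
    simp

section Differentials

variable {A B}
variable {P Q R : Type u} [CommRing P] [Algebra A P] [CommRing Q] [Algebra A Q]
  [Algebra P B] [IsScalarTower A P B] [Algebra Q B] [IsScalarTower A Q B]

/-- The `A`-derivation `P → B ⊗_Q Ω¹_{Q/A}`, `p ↦ 1 ⊗ d(g p)`, of a map `g : P → Q` of `A`-algebras
over `B`. -/
def diffDer (g : P →ₐ[A] Q) (hg : ∀ p, algebraMap Q B (g p) = algebraMap P B p) :
    Derivation A P (B ⊗[Q] Ω[Q⁄A]) where
  toFun p := (1 : B) ⊗ₜ[Q] D A Q (g p)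
  map_add' p q := by simp [tmul_add]
  map_smul' a p := by
    rw [map_smul, Derivation.map_smul, RingHom.id_apply, ← algebraMap_smul Q a (D A Q (g p)),
      ← smul_tmul, smul_tmul', Algebra.smul_def, ← IsScalarTower.algebraMap_apply,
      Algebra.smul_def]
  map_one_eq_zero' := by
    change (1 : B) ⊗ₜ[Q] D A Q (g 1) = 0
    simp
  leibniz' p q := by
    have h (p : P) (x : Ω[Q⁄A]) : (1 : B) ⊗ₜ[Q] (g p • x) = p • ((1 : B) ⊗ₜ[Q] x) := by
      rw [← smul_tmul, smul_tmul', Algebra.smul_def, Algebra.smul_def, hg]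
    change (1 : B) ⊗ₜ[Q] D A Q (g (p * q)) = p • (1 : B) ⊗ₜ[Q] D A Q (g q) +
      q • (1 : B) ⊗ₜ[Q] D A Q (g p)
    rw [map_mul, Derivation.leibniz, tmul_add, h, h]

/-- The map `B ⊗_P Ω¹_{P/A} → B ⊗_Q Ω¹_{Q/A}`, `b ⊗ dp ↦ b ⊗ d(g p)`, induced by a map `g : P → Q`
of `A`-algebras over `B`. -/
def diffMap (g : P →ₐ[A] Q) (hg : ∀ p, algebraMap Q B (g p) = algebraMap P B p) :
    B ⊗[P] Ω[P⁄A] →ₗ[B] B ⊗[Q] Ω[Q⁄A] :=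
  LinearMap.liftBaseChange B (diffDer g hg).liftKaehlerDifferential

theorem diffMap_tmul_D (g : P →ₐ[A] Q) (hg : ∀ p, algebraMap Q B (g p) = algebraMap P B p)
    (b : B) (p : P) : diffMap g hg (b ⊗ₜ D A P p) = b ⊗ₜ D A Q (g p) := by
  rw [diffMap, LinearMap.liftBaseChange_tmul, Derivation.liftKaehlerDifferential_comp_D]
  change b • ((1 : B) ⊗ₜ[Q] D A Q (g p)) = _
  rw [smul_tmul', smul_eq_mul, mul_one]

end Differentials

variable {A B} in
/-- `B` as an algebra over `P`, through the structure map `P → B`. -/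
@[reducible]
def AlgOver.algebra (P : AlgOver A B) : Algebra P.left B := P.toB.toRingHom.toAlgebra

attribute [local instance] AlgOver.algebra

instance (P : AlgOver A B) : IsScalarTower A P.left B :=
  IsScalarTower.of_algebraMap_eq fun a => (P.toB.commutes a).symm

/-- The functor sending an `A`-algebra `P` over `B` to the `B`-module `B ⊗_P Ω¹_{P/A}`. -/
def diff : AlgOver A B ⥤ ModuleCat.{u} B where
  obj P := ModuleCat.of B (B ⊗[P.left] Ω[P.left⁄A])
  map g := ModuleCat.ofHom (diffMap (AlgOver.map g) (AlgOver.toB_map g))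
  map_id P := by
    ext : 1
    refine diff_hom_ext fun p => (diffMap_tmul_D _ _ _ _).trans rfl
  map_comp f g := by
    ext : 1
    refine diff_hom_ext fun p => (diffMap_tmul_D _ _ _ _).trans ?_
    exact ((congrArg (diffMap (AlgOver.map g) (AlgOver.toB_map g))
      (diffMap_tmul_D (AlgOver.map f) (AlgOver.toB_map f) 1 p)).trans
      (diffMap_tmul_D _ _ _ _)).symm

variable {A B} in
/-- The natural map `B ⊗_P Ω¹_{P/A} → Ω¹_{B/A}`, `b ⊗ dp ↦ b d(p)`. -/
def toKaehler (P : AlgOver A B) : (diff A B).obj P ⟶ ModuleCat.of B Ω[B⁄A] :=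
  ModuleCat.ofHom (KaehlerDifferential.mapBaseChange A P.left B)

theorem diff_map_toKaehler {P Q : AlgOver A B} (g : P ⟶ Q) :
    (diff A B).map g ≫ toKaehler Q = toKaehler P := by
  ext : 1
  refine diff_hom_ext fun p => ?_
  refine (congrArg (KaehlerDifferential.mapBaseChange A Q.left B)
    (diffMap_tmul_D (AlgOver.map g) (AlgOver.toB_map g) 1 p)).trans ?_
  change _ = KaehlerDifferential.mapBaseChange A P.left B (1 ⊗ₜ D A P.left p)
  rw [KaehlerDifferential.mapBaseChange_tmul, KaehlerDifferential.mapBaseChange_tmul,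
    KaehlerDifferential.map_D, KaehlerDifferential.map_D]
  exact congrArg (fun b => (1 : B) • D A B b) (AlgOver.toB_map g p)

/-! ### The cotangent complex -/

/-- `A → B` regarded as an `A`-algebra over `B`. -/
def selfOver : AlgOver A B := Over.mk (𝟙 (CommAlgCat.of A B))

/-- The cotangent complex as a chain complex of `B`-modules: the chain complex of the simplicial
`B`-module `B ⊗_{P_•} Ω¹_{P_•/A}`, where `P_•` is the standard simplicial resolution of `B` by
polynomial `A`-algebras, `P_0 = A[B]`, `P_1 = A[A[B]]`, and so on. -/
def cotangentChain : ChainComplex (ModuleCat.{u} B) ℕ :=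
  barComplex (freeAlg A B) (freeAlgCounit A B) (selfOver A B) (diff A B)

/-- The map `B ⊗_{P_0} Ω¹_{P_0/A} → Ω¹_{B/A}` induced by the augmentation `P_0 → B`. -/
def augZero : (cotangentChain A B).X 0 ⟶ ModuleCat.of B Ω[B⁄A] :=
  toKaehler ((freeAlg A B).obj (selfOver A B))

theorem d_comp_augZero : (cotangentChain A B).d 1 0 ≫ augZero A B = 0 := by
  have h : (cotangentChain A B).d 1 0 =
      altFace (freeAlg A B) (freeAlgCounit A B) (selfOver A B) (diff A B) 1 :=
    barComplex_d _ _ _ _ 0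
  have h0 : altFaceG (freeAlg A B) (freeAlgCounit A B) (selfOver A B) (diff A B) 0 =
      (diff A B).map ((freeAlg A B).map
        (counit (freeAlg A B) (freeAlgCounit A B) (selfOver A B) 0)) :=
    altFace_zero (freeAlg A B) (freeAlgCounit A B) (selfOver A B) (freeAlg A B ⋙ diff A B)
  rw [h, altFace_succ, h0]
  refine (Preadditive.sub_comp _ _ _).trans (sub_eq_zero.2 ?_)
  exact (diff_map_toKaehler A B _).trans (diff_map_toKaehler A B _).symm

/-- The augmentation, as a map of chain complexes to `Ω¹_{B/A}` placed in degree `0`. -/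
def chainAug : cotangentChain A B ⟶
    (ChainComplex.single₀ (ModuleCat.{u} B)).obj (ModuleCat.of B Ω[B⁄A]) :=
  (ChainComplex.toSingle₀Equiv _ _).symm ⟨augZero A B, d_comp_augZero A B⟩

/-- The cotangent complex `L_{B/A}`, as a cochain complex of `B`-modules concentrated in degrees
`≤ 0`. -/
def cotangentComplex : CochainComplex (ModuleCat.{u} B) ℤ :=
  (cotangentChain A B).extend ComplexShape.embeddingDownNat

/-- The natural map `L_{B/A} → Ω¹_{B/A}`. -/
def aug : cotangentComplex A B ⟶
    (CochainComplex.singleFunctor (ModuleCat.{u} B) 0).obj (ModuleCat.of B Ω[B⁄A]) :=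
  HomologicalComplex.extendMap (chainAug A B) ComplexShape.embeddingDownNat ≫
    (HomologicalComplex.extendSingleIso ComplexShape.embeddingDownNat
      (ModuleCat.of B Ω[B⁄A]) (i := 0) (i' := 0) (by simp)).hom

end Algebras

/-! ### Ext groups -/

section Ext

variable {B : Type u} [CommRing B] [HasDerivedCategory.{w} (ModuleCat.{u} B)]

/-- `Extⁿ_B(K, M) = Hom_{D(B)}(K, M[n])` for a complex `K` of `B`-modules and a `B`-module `M`. -/
abbrev ExtComplex (K : CochainComplex (ModuleCat.{u} B) ℤ) (M : ModuleCat.{u} B) (n : ℤ) :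
    Type w :=
  ShiftedHom (DerivedCategory.Q.obj K) ((DerivedCategory.singleFunctor _ 0).obj M) n

variable (A : Type u) [CommRing A] [Algebra A B]

/-- The natural homomorphism `Ext¹_B(Ω¹_{B/A}, M) → Ext¹_B(L_{B/A}, M)`, given by composition with
`L_{B/A} → Ω¹_{B/A}`. -/
def extMap (M : ModuleCat.{u} B) :
    Abelian.Ext.{u} (ModuleCat.of B Ω[B⁄A]) M 1 →+ ExtComplex (cotangentComplex A B) M 1 where
  toFun α := DerivedCategory.Q.map (aug A B) ≫ α.hom
  map_zero' := by
    rw [Abelian.Ext.zero_hom]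
    exact Limits.comp_zero
  map_add' α β := by
    rw [Abelian.Ext.add_hom]
    exact Preadditive.comp_add _ _ _ _ _ _

end Ext

/-! ### Square-zero extensions -/

/-- A square-zero extension `0 → M → E → B → 0` of `B` by `M` over `A`. The ideal `i(M)` is of
square zero, and `i` is compatible with the module structures: `M` is an `E`-module through
`π`. -/
structure SquareZeroExt (A B M : Type u) [CommRing A] [CommRing B] [Algebra A B]
    [AddCommGroup M] [Module B M] where
  /-- The ring `E`. -/
  E : Type u
  [commRing : CommRing E]
  [algebra : Algebra A E]
  /-- The inclusion of `M`. -/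
  i : M →+ E
  /-- The projection onto `B`. -/
  π : E →ₐ[A] B
  injective : Function.Injective i
  exact : Function.Exact i π
  surjective : Function.Surjective π
  mul_eq_zero : ∀ m m' : M, i m * i m' = 0
  smul_i : ∀ (e : E) (m : M), i (π e • m) = e * i m

attribute [instance] SquareZeroExt.commRing SquareZeroExt.algebra

/-- A square-zero extension is trivial if `E → B` has a section which is a homomorphism of
`A`-algebras; equivalently, if the extension is isomorphic to `B ⊕ M`. -/
def SquareZeroExt.IsTrivial {A B M : Type u} [CommRing A] [CommRing B] [Algebra A B]
    [AddCommGroup M] [Module B M] (S : SquareZeroExt A B M) : Prop :=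
  ∃ s : B →ₐ[A] S.E, ∀ b, S.π (s b) = b

end Cotangent
end

/-! Choose `0 → M → I → Q → 0` with `I` injective. Since `Ext¹(Ω, I) = 0`, every class in `Ext¹(Ω,
M)` is the pullback of this sequence's class along some `h : Ω → Q`, and it vanishes as soon as `h`
lifts to `I`. Both halves of the theorem are therefore lifting statements about `h`.

Injectivity (`extMap_injective`): if the class dies on `L`, the long exact sequence of the triangle
`M → I → Q → M[1]` lifts `L → Ω → Q` to `L → I` in `D(B)`. Applying `H⁰` gives a lift of `h` itself,
because `H⁰(L) → Ω` is an isomorphism (`exists_lift_of_comp_singleδ_eq_zero`). So the only fact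
needed about `L` is its `H⁰`, that is, exactness of `L₁ → L₀ → Ω → 0` (`exact_d_augZero`,
`augZero_surjective`).

Non-trivial extensions (`exists_squareZeroExt_not_isTrivial`): no derived category is needed. The
pairs `(b, x)` in `B ⊕ I` with `h (db) = g x` form a square-zero extension of `B` by `M`. An algebra
section is `b ↦ (b, δ b)` with `δ : B → I` an `A`-derivation, and the linear map `Ω → I` attached to
`δ` lifts `h`. -/

noncomputable section

open TensorProduct KaehlerDifferential

namespace Cotangent

/-! ### Square-zero extensions from maps out of the differentials -/

section Extension

variable {A B M I Q : Type u} [CommRing A] [CommRing B] [Algebra A B]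
  [AddCommGroup M] [Module B M] [AddCommGroup I] [Module B I] [Module Bᵐᵒᵖ I]
  [IsCentralScalar B I] [Module A I] [IsScalarTower A B I] [AddCommGroup Q] [Module B Q]

/-- The subalgebra of the trivial square-zero extension `B ⊕ I` of all `(b, x)` with
`h (d b) = g x`. -/
def kaehlerSubalgebra (g : I →ₗ[B] Q) (h : Ω[B⁄A] →ₗ[B] Q) :
    Subalgebra A (TrivSqZeroExt B I) where
  carrier := {x | h (D A B x.fst) = g x.snd}
  mul_mem' {x y} hx hy := by
    simp only [Set.mem_ofPred_eq] at hx hy ⊢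
    simp [hx, hy]
  add_mem' {x y} hx hy := by
    simp only [Set.mem_ofPred_eq] at hx hy ⊢
    simp [hx, hy]
  algebraMap_mem' a := by
    simp [TrivSqZeroExt.algebraMap_eq_inl']

/-- The square-zero extension of `B` by `M` obtained by pulling back an exact sequence
`0 → M → I → Q → 0` along `B → Ω¹_{B/A} → Q`. -/
def SquareZeroExt.ofKaehler (f : M →ₗ[B] I) (g : I →ₗ[B] Q) (h : Ω[B⁄A] →ₗ[B] Q)
    (hf : Function.Injective f) (hfg : Function.Exact f g) (hg : Function.Surjective g) :
    SquareZeroExt A B M where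
  E := kaehlerSubalgebra g h
  i :=
    { toFun := fun m => ⟨TrivSqZeroExt.inr (f m), by
        change h (D A B 0) = g (f m)
        rw [map_zero, map_zero, hfg.apply_apply_eq_zero]⟩
      map_zero' := by ext <;> simp
      map_add' := fun m m' => by ext <;> simp }
  π := (TrivSqZeroExt.fstHom A B I).comp (kaehlerSubalgebra g h).val
  injective m m' hm := hf (TrivSqZeroExt.inr_injective (congrArg Subtype.val hm))
  exact := by
    rintro ⟨x, hx⟩
    constructor
    · intro hx0
      have hx0 : x.fst = 0 := hx0
      have hx : h (D A B x.fst) = g x.snd := hx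
      rw [hx0, map_zero, map_zero] at hx
      obtain ⟨m, hm⟩ := (hfg _).1 hx.symm
      exact ⟨m, Subtype.ext (TrivSqZeroExt.ext hx0.symm hm)⟩
    · rintro ⟨m, hm⟩
      rw [← hm]
      rfl
  surjective b := by
    obtain ⟨x, hx⟩ := hg (h (D A B b))
    exact ⟨⟨(b, x), hx.symm⟩, rfl⟩
  mul_eq_zero m m' := Subtype.ext (TrivSqZeroExt.inr_mul_inr _ _ _)
  smul_i := by
    rintro ⟨x, hx⟩ m
    refine Subtype.ext (TrivSqZeroExt.ext ?_ ?_)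
    · simp
    · change f (x.fst • m) = _
      simp

/-- The second coordinate of an algebra section is a derivation `B → I`, so it factors through `Ω`;
the equation defining the subalgebra says that this factorization lifts `h`. -/
theorem SquareZeroExt.exists_lift_of_isTrivial (f : M →ₗ[B] I) (g : I →ₗ[B] Q)
    (h : Ω[B⁄A] →ₗ[B] Q) (hf : Function.Injective f) (hfg : Function.Exact f g)
    (hg : Function.Surjective g)
    (hS : (SquareZeroExt.ofKaehler f g h hf hfg hg).IsTrivial) :
    ∃ k : Ω[B⁄A] →ₗ[B] I, g ∘ₗ k = h := by
  obtain ⟨s, hs⟩ := hS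
  let t : B →ₐ[A] TrivSqZeroExt B I := (kaehlerSubalgebra g h).val.comp s
  have ht (b : B) : (t b).fst = b := hs b
  have ht' (b : B) : h (D A B b) = g (t b).snd := by
    conv_lhs => rw [← ht b]
    exact (s b).2
  -- As the first coordinate of `t` is the identity, multiplicativity of `t` read in the second
  -- coordinate is the Leibniz rule.
  let δ : Derivation A B I := Derivation.mk' (TrivSqZeroExt.sndHom B I |>.restrictScalars A
      |>.comp t.toLinearMap) fun a b => by
    change (t (a * b)).snd = a • (t b).snd + b • (t a).snd
    rw [map_mul, TrivSqZeroExt.snd_mul, ht, ht, op_smul_eq_smul]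
  refine ⟨δ.liftKaehlerDifferential, ?_⟩
  refine LinearMap.ext_on_range
    (KaehlerDifferential.span_range_derivation A B) fun b => ?_
  change g (δ.liftKaehlerDifferential (D A B b)) = _
  rw [Derivation.liftKaehlerDifferential_comp_D, ht']
  rfl

end Extension

/-! ### The zeroth cohomology of the cotangent complex -/

section Exactness

variable (A B : Type u) [CommRing A] [CommRing B] [Algebra A B]

attribute [local instance] AlgOver.algebra

variable {A B} in
/-- The element `1 ⊗ dp` of `B ⊗_P Ω¹_{P/A}`. -/
def AlgOver.tmulD (P : AlgOver A B) (p : P.left) : (diff A B).obj P :=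
  (1 : B) ⊗ₜ[P.left] D A P.left p

variable {A B} in
theorem AlgOver.tmulD_zero (P : AlgOver A B) : P.tmulD 0 = 0 :=
  (congrArg (TensorProduct.tmul _ _) (map_zero _)).trans (tmul_zero _ _)

variable {A B} in
/-- The variable `[p]` of the polynomial algebra `A[P]`. -/
def AlgOver.var (P : AlgOver A B) (p : P.left) : ((freeAlg A B).obj P).left :=
  (MvPolynomial.X p : MvPolynomial P.left A)

theorem diff_map_tmulD {P Q : AlgOver A B} (g : P ⟶ Q) (p : P.left) :
    ((diff A B).map g).hom (P.tmulD p) = Q.tmulD (AlgOver.map g p) :=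
  diffMap_tmul_D _ _ _ _

theorem map_freeAlgCounit_var (P : AlgOver A B) (p : P.left) :
    AlgOver.map ((freeAlgCounit A B).app P) (P.var p) = p :=
  MvPolynomial.aeval_X _ _

theorem map_freeAlg_map_var {P Q : AlgOver A B} (g : P ⟶ Q) (p : P.left) :
    AlgOver.map ((freeAlg A B).map g) (P.var p) = Q.var (AlgOver.map g p) :=
  MvPolynomial.rename_X _ _

variable {A B} in
theorem toKaehler_surjective (P : AlgOver A B) (hP : Function.Surjective P.toB) :
    Function.Surjective (toKaehler P).hom :=
  KaehlerDifferential.mapBaseChange_surjective A P.left B hP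

-- The conormal sequence: with `J = ker (P → B)`, the kernel of `B ⊗ Ω_P → Ω_B` is the image of
-- `J/J²`, and every class of `J/J²` has a representative in `J`. Thus a single `dp` suffices, with
-- no sums.
variable {A B} in
theorem exists_tmulD_eq_of_toKaehler_eq_zero (P : AlgOver A B) (hP : Function.Surjective P.toB)
    (x : (diff A B).obj P) (hx : (toKaehler P).hom x = 0) :
    ∃ p : P.left, P.toB p = 0 ∧ P.tmulD p = x := by
  obtain ⟨y, rfl⟩ :=
    (KaehlerDifferential.exact_kerCotangentToTensor_mapBaseChange A P.left B hP x).1 hx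
  obtain ⟨y, rfl⟩ := Ideal.toCotangent_surjective _ y
  exact ⟨y.1, y.2, rfl⟩

theorem toB_freeAlg_surjective :
    Function.Surjective ((freeAlg A B).obj (selfOver A B)).toB := fun b =>
  ⟨(selfOver A B).var b, MvPolynomial.aeval_X _ _⟩

/-- The differential `L₁ → L₀` sends `1 ⊗ d[p]` to `1 ⊗ dp - 1 ⊗ d[ε p]`. -/
theorem cotangentChain_d_tmulD_var (p : ((freeAlg A B).obj (selfOver A B)).left) :
    ((cotangentChain A B).d 1 0).hom
      (((freeAlg A B).obj ((freeAlg A B).obj (selfOver A B))).tmulD (AlgOver.var _ p)) =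
    (((freeAlg A B).obj (selfOver A B)).tmulD p -
      ((freeAlg A B).obj (selfOver A B)).tmulD
        ((selfOver A B).var (((freeAlg A B).obj (selfOver A B)).toB p)) :
      (diff A B).obj ((freeAlg A B).obj (selfOver A B))) := by
  have h1 : altFaceG (freeAlg A B) (freeAlgCounit A B) (selfOver A B) (diff A B) 0 =
      (diff A B).map ((freeAlg A B).map ((freeAlgCounit A B).app (selfOver A B))) :=
    altFace_zero (freeAlg A B) (freeAlgCounit A B) (selfOver A B) (freeAlg A B ⋙ diff A B)
  have h : (cotangentChain A B).d 1 0 =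
      (diff A B).map (Y := (freeAlg A B).obj (selfOver A B))
          ((freeAlgCounit A B).app ((freeAlg A B).obj (selfOver A B))) -
        (diff A B).map (Y := (freeAlg A B).obj (selfOver A B))
          ((freeAlg A B).map ((freeAlgCounit A B).app (selfOver A B))) :=
    (barComplex_d _ _ _ _ 0).trans ((altFace_succ _ _ _ _ 0).trans (congrArg _ h1))
  rw [h]
  refine congrArg₂ (· - ·) ((diff_map_tmulD A B _ _).trans ?_)
    ((diff_map_tmulD A B _ _).trans ?_)
  · rw [map_freeAlgCounit_var]
  · rw [map_freeAlg_map_var]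
    rfl

/-- By the conormal sequence a kernel element is `1 ⊗ dy` with `y` mapping to `0` in `B`, and such
an element is an explicit boundary. -/
theorem exact_d_augZero :
    Function.Exact ((cotangentChain A B).d 1 0).hom (augZero A B).hom := by
  intro x
  constructor
  · intro hx
    obtain ⟨y, hy, rfl⟩ :=
      exists_tmulD_eq_of_toKaehler_eq_zero _ (toB_freeAlg_surjective A B) x hx
    -- The witness is `1 ⊗ d[y] - 1 ⊗ d[0]`. The boundary of the first term is `dy - d[0]`, where
    -- the variable `[0]` of `A[B]` need not have zero differential; the boundary of the second is
    -- `d0 - d[0] = -d[0]`, which cancels the excess.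
    refine ⟨_ - _, (map_sub _ _ _).trans ((congrArg₂ (· - ·)
      (cotangentChain_d_tmulD_var A B y) (cotangentChain_d_tmulD_var A B 0)).trans ?_)⟩
    rw [hy, map_zero, AlgOver.tmulD_zero]
    exact (congrArg _ (zero_sub _)).trans ((sub_neg_eq_add _ _).trans (sub_add_cancel _ _))
  · rintro ⟨y, rfl⟩
    exact congrArg (fun f => f.hom y) (d_comp_augZero A B)

theorem augZero_surjective : Function.Surjective (augZero A B).hom :=
  toKaehler_surjective _ (toB_freeAlg_surjective A B)

theorem quasiIsoAt_chainAug : QuasiIsoAt (chainAug A B) 0 := by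
  -- No non-zero differential leaves degree `0`, so the claim reduces to exactness at `L₀` and
  -- surjectivity of the augmentation.
  rw [ChainComplex.quasiIsoAt₀_iff, ShortComplex.quasiIso_iff_of_zeros' _
    ((cotangentChain A B).shape 0 0 (by simp)) rfl rfl]
  have h : (chainAug A B).f 0 = augZero A B :=
    ChainComplex.toSingle₀Equiv_symm_apply_f_zero _ _
  constructor
  · rw [ShortComplex.moduleCat_exact_iff_ker_sub_range]
    intro x hx
    exact (exact_d_augZero A B x).1 (h ▸ hx)
  · change Epi ((chainAug A B).f 0)
    rw [h]
    exact (ModuleCat.epi_iff_surjective (augZero A B)).2 (augZero_surjective A B)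

theorem quasiIsoAt_aug : QuasiIsoAt (aug A B) 0 := by
  have h : QuasiIsoAt (HomologicalComplex.extendMap (chainAug A B)
      ComplexShape.embeddingDownNat) 0 :=
    (HomologicalComplex.quasiIsoAt_extendMap_iff _ _ (j := 0) (by simp)).2
      (quasiIsoAt_chainAug A B)
  exact quasiIsoAt_comp (hφ := h) (hφ' := quasiIsoAt_of_isIso (Iso.hom _) 0) _ _ _

end Exactness

/-! ### Lifting through a triangle and passing to `H⁰` -/

section Derived

variable {C : Type*} [Category C] [Abelian C] [HasDerivedCategory.{w} C]

open DerivedCategory Limits Pretriangulated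

/-- If `φ : Y ⟶ X` is an isomorphism on `H⁰`, then a morphism `h : X ⟶ S.X₃` for which the
composite `Y ⟶ X ⟶ S.X₃ ⟶ S.X₁[1]` vanishes lifts to `S.X₂`. -/
theorem exists_lift_of_comp_singleδ_eq_zero {S : ShortComplex C} (hS : S.ShortExact) {X : C}
    {Y : DerivedCategory C} (φ : Y ⟶ (singleFunctor C 0).obj X)
    (hφ : IsIso ((homologyFunctor C 0).map φ)) (h : X ⟶ S.X₃)
    (hh : φ ≫ (singleFunctor C 0).map h ≫ hS.singleδ = 0) :
    ∃ k : X ⟶ S.X₂, k ≫ S.g = h := by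
  -- Vanishing of the composite into `S.X₁[1]` gives a lift `ψ : Y ⟶ S.X₂` in the derived category.
  obtain ⟨ψ, hψ⟩ := Triangle.coyoneda_exact₃ _ hS.singleTriangle_distinguished
    (φ ≫ (singleFunctor C 0).map h) ((Category.assoc _ _ _).trans hh)
  change Y ⟶ (singleFunctor C 0).obj S.X₂ at ψ
  change _ = ψ ≫ (singleFunctor C 0).map S.g at hψ
  let e := singleFunctorCompHomologyFunctorIso C 0
  -- The lift is `H⁰(ψ) ∘ H⁰(φ)⁻¹`, with `H⁰` of an object placed in degree `0` identified with that
  -- object.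
  refine ⟨e.inv.app X ≫ inv ((homologyFunctor C 0).map φ) ≫ (homologyFunctor C 0).map ψ ≫
      e.hom.app S.X₂, ?_⟩
  have h1 : (homologyFunctor C 0).map φ ≫ (homologyFunctor C 0).map ((singleFunctor C 0).map h) =
      (homologyFunctor C 0).map ψ ≫ (homologyFunctor C 0).map ((singleFunctor C 0).map S.g) :=
    (Functor.map_comp _ _ _).symm.trans ((congrArg _ hψ).trans (Functor.map_comp _ _ _))
  have h2 : (homologyFunctor C 0).map ((singleFunctor C 0).map S.g) ≫ e.hom.app S.X₃ =
    e.hom.app S.X₂ ≫ S.g := e.hom.naturality S.g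
  have h3 : (homologyFunctor C 0).map ((singleFunctor C 0).map h) ≫ e.hom.app S.X₃ =
    e.hom.app X ≫ h := e.hom.naturality h
  rw [Category.assoc, Category.assoc, Category.assoc, ← h2, ← reassoc_of% h1, h3,
    IsIso.inv_hom_id_assoc]
  exact e.inv_hom_id_app_assoc X h

theorem isIso_homologyFunctor_map_Q_map {K L : CochainComplex C ℤ} (φ : K ⟶ L) (n : ℤ)
    (h : QuasiIsoAt φ n) : IsIso ((homologyFunctor C n).map (Q.map φ)) :=
  (NatIso.isIso_map_iff (homologyFunctorFactors C n) φ).2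
    (inferInstanceAs (IsIso (HomologicalComplex.homologyMap φ n)))

end Derived

/-! ### `Ext¹` by dimension shifting, and the two conclusions -/

/-- For every `M` there is an exact sequence `0 ⟶ M ⟶ I ⟶ Q ⟶ 0` such that every class in
`Ext¹(X, M)` comes from a morphism `X ⟶ Q`. -/
theorem exists_shortExact_forall_exists_comp_extClass_eq {C : Type*} [Category C] [Abelian C]
    [EnoughInjectives C] [HasExt.{w} C] (M : C) :
    ∃ (I Q : C) (f : M ⟶ I) (g : I ⟶ Q) (zero : f ≫ g = 0)
      (hS : (ShortComplex.mk f g zero).ShortExact),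
      ∀ (X : C) (α : Abelian.Ext.{w} X M 1),
        ∃ h : X ⟶ Q, (Abelian.Ext.mk₀ h).comp hS.extClass (zero_add 1) = α := by
  have hS : (ShortComplex.mk (Injective.ι M) (Limits.cokernel.π (Injective.ι M))
    (Limits.cokernel.condition _)).ShortExact := { exact := ShortComplex.exact_cokernel _ }
  refine ⟨_, _, _, _, _, hS, fun X α => ?_⟩
  -- The image of `α` in `Ext¹(X, I)` is zero, so `α` comes from `Ext⁰(X, Q) = Hom(X, Q)`.
  obtain ⟨y, hy⟩ := Abelian.Ext.covariant_sequence_exact₁ X hS α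
    (Abelian.Ext.eq_zero_of_injective (I := Injective.under M) _) rfl
  obtain ⟨h, rfl⟩ := (Abelian.Ext.mk₀_bijective _ _).2 y
  exact ⟨h, hy⟩

/-- Consecutive maps in the long exact sequence compose to zero: `S.g` followed by the extension
class vanishes. -/
theorem comp_extClass_eq_zero_of_lift {C : Type*} [Category C] [Abelian C]
    [HasExt.{w} C] {S : ShortComplex C} (hS : S.ShortExact) {X : C} (k : X ⟶ S.X₂) :
    (Abelian.Ext.mk₀ (k ≫ S.g)).comp hS.extClass (zero_add 1) = 0 := by
  rw [← Abelian.Ext.mk₀_comp_mk₀_assoc, hS.comp_extClass, Abelian.Ext.comp_zero]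

theorem extMap_injective (A B : Type u) [CommRing A] [CommRing B] [Algebra A B]
    [HasDerivedCategory.{w} (ModuleCat.{u} B)] (M : ModuleCat.{u} B) :
    Function.Injective (extMap A M) := by
  rw [injective_iff_map_eq_zero]
  intro α hα
  obtain ⟨I, Q, f, g, zero, hS, hex⟩ := exists_shortExact_forall_exists_comp_extClass_eq.{u} M
  obtain ⟨h, rfl⟩ := hex _ α
  obtain ⟨k, rfl⟩ := exists_lift_of_comp_singleδ_eq_zero hS
    (X := ModuleCat.of B Ω[B⁄A]) (DerivedCategory.Q.map (aug A B))
    (isIso_homologyFunctor_map_Q_map _ _ (quasiIsoAt_aug A B)) h (by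
      -- In the derived category the extension class is the connecting morphism `S.X₃ → S.X₁[1]`, so
      -- `hα` is exactly the vanishing required.
      refine Eq.trans ?_ hα
      change _ = DerivedCategory.Q.map (aug A B) ≫ _
      rw [Abelian.Ext.comp_hom, Abelian.Ext.mk₀_hom, ShiftedHom.mk₀_comp,
        ShortComplex.ShortExact.extClass_hom]
      rfl)
  exact comp_extClass_eq_zero_of_lift hS k

theorem exists_squareZeroExt_not_isTrivial (A B M : Type u) [CommRing A] [CommRing B]
    [Algebra A B] [AddCommGroup M] [Module B M]
    [Nontrivial (Abelian.Ext.{u} (ModuleCat.of B Ω[B⁄A]) (ModuleCat.of B M) 1)] :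
    ∃ S : SquareZeroExt A B M, ¬ S.IsTrivial := by
  obtain ⟨α, hα⟩ := exists_ne
    (0 : Abelian.Ext.{u} (ModuleCat.of B Ω[B⁄A]) (ModuleCat.of B M) 1)
  obtain ⟨I, Q, f, g, zero, hS, hex⟩ :=
    exists_shortExact_forall_exists_comp_extClass_eq.{u} (ModuleCat.of B M)
  obtain ⟨h, rfl⟩ := hex _ α
  -- The algebra `B ⊕ I` needs an `A`-action and a right `B`-action on `I`; both are induced by the
  -- given `B`-action, `B` being commutative.
  let : Module A I := Module.compHom I (algebraMap A B)
  have : IsScalarTower A B I := IsScalarTower.of_algebraMap_smul fun _ _ => rfl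
  let : Module Bᵐᵒᵖ I := Module.compHom I ((RingHom.id B).fromOpposite mul_comm)
  have : IsCentralScalar B I := ⟨fun _ _ => rfl⟩
  refine ⟨SquareZeroExt.ofKaehler f.hom g.hom h.hom
    ((ModuleCat.mono_iff_injective f).1 hS.mono_f)
    ((ShortComplex.ShortExact.moduleCat_exact_iff_function_exact _).1 hS.exact)
    ((ModuleCat.epi_iff_surjective g).1 hS.epi_g), fun hT => hα ?_⟩
  obtain ⟨k, hk⟩ := SquareZeroExt.exists_lift_of_isTrivial _ _ _ _ _ _ hT
  obtain rfl : ModuleCat.ofHom k ≫ g = h := ModuleCat.hom_ext hk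
  exact comp_extClass_eq_zero_of_lift hS (ModuleCat.ofHom k)

end Cotangent

end

theorem mainTheorem11 (A B : Type u) [CommRing A] [CommRing B] [Algebra A B]
    (M : Type u) [AddCommGroup M] [Module B M] [HasDerivedCategory.{w} (ModuleCat.{u} B)] :
    Function.Injective (Cotangent.extMap A (ModuleCat.of B M)) ∧
      (Nontrivial (Abelian.Ext.{u} (ModuleCat.of B Ω[B⁄A]) (ModuleCat.of B M) 1) →
        ∃ S : Cotangent.SquareZeroExt A B M, ¬ S.IsTrivial) := by
  refine ⟨Cotangent.extMap_injective A B _, fun _ => ?_⟩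
  exact Cotangent.exists_squareZeroExt_not_isTrivial A B M
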